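/- **Theorem (High-dimensional subvarieties).** Let $\mathbb{K}$ be an infinite field with algebraic closure $\overline{\mathbb{K}}$, and let $d, m, n_1,\dots,n_d$ be non-negative integers. For a function $f:\mathbb{K}^{n_1}\times\cdots\times\mathbb{K}^{n_d}\to\mathbb{K}$ write $\deg_j f = e$ if, for every choice of $\mathsf{v}_s\in\mathbb{K}^{n_s}$ ($s\ne j$), the function $x_j\mapsto f(\mathsf{v}_1,\dots,\mathsf{v}_{j-1},x_j,\mathsf{v}_{j+1},\dots,\mathsf{v}_d)$ on $\mathbb{K}^{n_j}$ is given by a homogeneous polynomial of degree $e$ (the zero polynomial being homogeneous of every degree). Write $\operatorname{mdeg} f\le(1,\dots,1)$ if for each $j\in\{1,\dots,d\}$ there is $e\le 1$ with $\deg_j f=e$. Put $N=n_1+\cdots+n_d$ and identify $\mathbb{K}^{n_1}\times\cdots\times\mathbb{K}^{n_d}$ with $\mathbb{K}^N\subseteq\overline{\mathbb{K}}^N$. For $S\subseteq\mathbb{K}^N$ let $$\overline{S}=\{x\in\overline{\mathbb{K}}^N : g(x)=0 \text{ for all } g\in\mathbb{K}[x_1,\dots,x_N] \text{ vanishing on }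 S\}.$$ Let $f_1,\dots,f_m:\mathbb{K}^{n_1}\times\cdots\times\mathbb{K}^{n_d}\to\mathbb{K}$ be functions with $\operatorname{mdeg} f_i\le(1,\dots,1)$ for all $i$. Then for all $c_1,\dots,c_m\in\mathbb{K}$ and every $\mathsf{v}\in\mathbb{K}^{n_1}\times\cdots\times\mathbb{K}^{n_d}$ with $(f_1(\mathsf{v}),\dots,f_m(\mathsf{v}))=(c_1,\dots,c_m)$, there exists a subset $$W\subseteq\{\mathsf{w}\in\mathbb{K}^{n_1}\times\cdots\times\mathbb{K}^{n_d} : (f_1(\mathsf{w}),\dots,f_m(\mathsf{w}))=(c_1,\dots,c_m)\}$$ such that (a) $\mathsf{v}\in\overline{W}$; (b) $\overline{W}$ is irreducible in the Zariski topology of $\overline{\mathbb{K}}^N$; (c) $\operatorname{codim}\overline{W}\le 2^d m$, where $\operatorname{codim}\overline{W}=N-\dim\overline{W}$ and $\dim$ is the Krull dimension for the Zariski topology. -/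

import Mathlib

noncomputable section

namespace MultilinearVariety

section Multidegree

variable {K : Type*} [Field K] {d : ℕ} {n : Fin d → ℕ}

/-- `deg_j f = e`: for every choice of the blocks other than the `j`-th one, `f` is, as a function
of the `j`-th block, given by a homogeneous polynomial of degree `e` (the zero polynomial is
homogeneous of every degree). -/
def HasDegreeIn (f : (∀ j : Fin d, Fin (n j) → K) → K) (j : Fin d) (e : ℕ) : Prop :=
  ∀ v : (∀ j : Fin d, Fin (n j) → K), ∃ p : MvPolynomial (Fin (n j)) K,
    p.IsHomogeneous e ∧ ∀ x : Fin (n j) → K, f (Function.update v j x) = MvPolynomial.eval x p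

/-- `mdeg f ≤ (e_1, …, e_d)`. -/
def MultidegreeLE (f : (∀ j : Fin d, Fin (n j) → K) → K) (e : Fin d → ℕ) : Prop :=
  ∀ j : Fin d, ∃ k : ℕ, k ≤ e j ∧ HasDegreeIn f j k

/-- The identification of `K^{n_1} × ⋯ × K^{n_d}` with the affine space `K^{n_1 + ⋯ + n_d}`, whose
coordinates are indexed by the pairs (block, position in the block). -/
def flatten (v : ∀ j : Fin d, Fin (n j) → K) : (Σ j : Fin d, Fin (n j)) → K :=
  fun i => v i.1 i.2

end Multidegree

section Zariski

variable {σ : Type*}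

/-- The set of common zeros in `L^σ` of a set of polynomials over `L`. -/
def commonZeros {L : Type*} [Field L] (P : Set (MvPolynomial σ L)) : Set (σ → L) :=
  {x | ∀ p ∈ P, MvPolynomial.eval x p = 0}

/-- The Zariski topology on `L^σ`: the closed sets are the sets of common zeros of polynomials with
coefficients in `L`. -/
@[reducible] def zariskiTopology (L : Type*) [Field L] (σ : Type*) : TopologicalSpace (σ → L) :=
  TopologicalSpace.ofClosed {Z | ∃ P : Set (MvPolynomial σ L), Z = commonZeros P}
    ⟨{1}, by ext x; simp [commonZeros]⟩
    (by
      intro A hA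
      refine ⟨{p | ∃ P : Set (MvPolynomial σ L), commonZeros P ∈ A ∧ p ∈ P}, ?_⟩
      ext x
      constructor
      · rintro hx p ⟨P, hP, hp⟩
        exact hx _ hP p hp
      · intro hx Z hZ
        obtain ⟨P, rfl⟩ := hA hZ
        exact fun p hp => hx p ⟨P, hZ, hp⟩)
    (by
      rintro _ ⟨P, rfl⟩ _ ⟨Q, rfl⟩
      refine ⟨{r | ∃ p ∈ P, ∃ q ∈ Q, r = p * q}, ?_⟩
      ext x
      constructor
      · rintro (hx | hx) r ⟨p, hp, q, hq, rfl⟩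
        · simp [hx p hp]
        · simp [hx q hq]
      · intro hx
        by_contra hcon
        simp only [Set.mem_union, not_or, commonZeros, Set.mem_ofPred_eq, not_forall] at hcon
        obtain ⟨⟨p, hp, hpx⟩, ⟨q, hq, hqx⟩⟩ := hcon
        have h := hx (p * q) ⟨p, hp, q, hq, rfl⟩
        rw [map_mul] at h
        exact (mul_ne_zero hpx hqx) h)

/-- Irreducibility (in particular, non-emptiness) in the Zariski topology of `L^σ`. -/
def IsZariskiIrreducible {L : Type*} [Field L] (S : Set (σ → L)) : Prop :=
  @IsIrreducible (σ → L) (zariskiTopology L σ) S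

/-- The dimension of a subset of `L^σ`: the Krull dimension of the subspace topology induced by the
Zariski topology (it is `⊥` for the empty set). -/
def zariskiDim {L : Type*} [Field L] (S : Set (σ → L)) : WithBot ℕ∞ :=
  @topologicalKrullDim S (@instTopologicalSpaceSubtype (σ → L) (· ∈ S) (zariskiTopology L σ))

/-- The codimension `#σ - dim S` of a subset `S` of `L^σ`, that is, the least `c` such that
`#σ ≤ dim S + c` (it is `⊤` for the empty set). -/
def zariskiCodim {L : Type*} [Field L] [Fintype σ] (S : Set (σ → L)) : ℕ∞ :=
  sInf {c : ℕ∞ | ((Fintype.card σ : ℕ) : WithBot ℕ∞) ≤ zariskiDim S + (c : WithBot ℕ∞)}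

/-- The closure in `K̄^σ` of a subset `S` of `K^σ`: the set of the points of `K̄^σ` at which all
polynomials with coefficients in `K` that vanish on `S` vanish. -/
def geometricClosure {K : Type*} [Field K] (S : Set (σ → K)) : Set (σ → AlgebraicClosure K) :=
  MvPolynomial.zeroLocus (AlgebraicClosure K) (MvPolynomial.vanishingIdeal K S)

end Zariski

end MultilinearVariety

end

/-!
The set `W` is the image of a polynomial map `φ : K^p → K^N` with `φ 0 = v`, where
`N ≤ p + 2 ^ d * m`.

The map is built one block at a time. Suppose the blocks before `k` already move polynomially with
parameters `a`, in such a way that `f i` keeps the value `f i v` at every point obtained by resetting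
any subset of the blocks to those of `v`. Since each `f i` is affine in the block `k`
(`MultidegreeLE.update_add`), a displacement of that block preserves this property if and only if it
solves one homogeneous linear equation for each `i` and each set of earlier blocks. These are
`2 ^ k * m` equations with coefficients in the ring `K[a]`, so there are at least `n k - 2 ^ k * m`
solutions over `K[a]` in triangular position (`exists_triangular_solutions`); their coefficients are
the new parameters (`FibreParametrization.exists_succ`). At most
`(1 + 2 + ⋯ + 2 ^ (d - 1)) * m ≤ 2 ^ d * m` parameters are lost in total.

As `K` is infinite, `K^p` is irreducible, and hence so is the closure of its image. No dimension
theory is needed for the codimension: the images of the subspaces `a_i = ⋯ = a_{p-1} = 0` have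
irreducible closures, and by triangularity some coordinate function is constant on the `i`-th image
but not on the next, so these closures form a strictly increasing chain of length `p`
(`le_zariskiDim_geometricClosure_range`). That all this can be done over the algebraic closure is
`geometricClosure_eq_closure`: expanding the coefficients along a basis of the algebraic closure
over `K` shows that polynomials over `K` already cut out the Zariski closure of a set of rational
points.
-/

namespace MultilinearVariety

open MvPolynomial

/-! ### Functions that are affine in each block -/

theorem _root_.MvPolynomial.IsHomogeneous.eval_eq_affine {R ι : Type*} [CommRing R] [Fintype ι]
    [DecidableEq ι] {p : MvPolynomial ι R} {e : ℕ} (hp : p.IsHomogeneous e) (he : e ≤ 1)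
    (x : ι → R) :
    eval x p = eval 0 p + ∑ l, x l * (eval (Pi.single l 1) p - eval 0 p) := by
  rcases Nat.le_one_iff_eq_zero_or_eq_one.1 he with rfl | rfl
  · rw [← totalDegree_zero_iff_isHomogeneous, totalDegree_eq_zero_iff_eq_C] at hp
    rw [hp]
    simp
  · rw [← mem_homogeneousSubmodule, homogeneousSubmodule_one_eq_span_X] at hp
    induction hp using Submodule.span_induction with
    | mem p hp =>
      obtain ⟨i, rfl⟩ := hp
      simp [Pi.single_apply]
    | zero => simp
    | add p q _ _ hp hq =>
      simp only [map_add]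
      rw [hp, hq, add_add_add_comm, ← Finset.sum_add_distrib]
      congr 1
      exact Finset.sum_congr rfl fun l _ => by ring
    | smul c p _ hp =>
      simp only [smul_eval]
      rw [hp, mul_add, Finset.mul_sum]
      congr 1
      exact Finset.sum_congr rfl fun l _ => by ring

section Blocks

variable {K : Type*} [Field K] {d : ℕ} {n : Fin d → ℕ}

/-- The coefficient of the `l`-th coordinate of the block `k` in `f`, seen as an affine function of
that block, the other blocks being those of `w`. -/
def slope (f : (∀ j : Fin d, Fin (n j) → K) → K) (k : Fin d) (l : Fin (n k))
    (w : ∀ j : Fin d, Fin (n j) → K) : K :=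
  f (Function.update w k (Pi.single l 1)) - f (Function.update w k 0)

theorem MultidegreeLE.eq_add_sum_slope {f : (∀ j : Fin d, Fin (n j) → K) → K}
    (hf : MultidegreeLE f (fun _ => 1)) (k : Fin d) (w : ∀ j : Fin d, Fin (n j) → K)
    (x : Fin (n k) → K) :
    f (Function.update w k x) = f (Function.update w k 0) + ∑ l, x l * slope f k l w := by
  obtain ⟨e, he, h⟩ := hf k
  obtain ⟨p, hp, hpf⟩ := h w
  simp only [slope, hpf]
  exact hp.eval_eq_affine he x

theorem MultidegreeLE.update_add {f : (∀ j : Fin d, Fin (n j) → K) → K}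
    (hf : MultidegreeLE f (fun _ => 1)) (k : Fin d) (w : ∀ j : Fin d, Fin (n j) → K)
    (y : Fin (n k) → K) :
    f (Function.update w k (w k + y)) = f w + ∑ l, y l * slope f k l w := by
  have h := hf.eq_add_sum_slope k w (w k)
  rw [Function.update_eq_self] at h
  rw [hf.eq_add_sum_slope, h, add_assoc, ← Finset.sum_add_distrib]
  simp [add_mul]

/-- The interpolation formula in each block shows that such a function is a polynomial. The blocks
are released one at a time; `w₀` holds the values of those still frozen. -/
theorem MultidegreeLE.exists_polynomial_piecewise {f : (∀ j : Fin d, Fin (n j) → K) → K}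
    (hf : MultidegreeLE f (fun _ => 1)) (T : Finset (Fin d)) :
    ∀ w₀ : ∀ j : Fin d, Fin (n j) → K, ∃ F : MvPolynomial (Σ j : Fin d, Fin (n j)) K,
      ∀ w, f (T.piecewise w w₀) = eval (flatten w) F := by
  induction T using Finset.induction_on with
  | empty => exact fun w₀ => ⟨C (f w₀), by simp⟩
  | insert k T hk ih =>
    intro w₀
    obtain ⟨F₀, hF₀⟩ := ih (Function.update w₀ k 0)
    choose F hF using fun l : Fin (n k) => ih (Function.update w₀ k (Pi.single l 1))
    refine ⟨F₀ + ∑ l, X ⟨k, l⟩ * (F l - F₀), fun w => ?_⟩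
    have key : ∀ y, Function.update (T.piecewise w w₀) k y =
        T.piecewise w (Function.update w₀ k y) := fun y => by
      rw [Finset.update_piecewise_of_notMem _ _ _ hk]
    rw [Finset.piecewise_insert, hf.eq_add_sum_slope]
    simp only [slope, key, hF₀, hF]
    simp [flatten]

theorem MultidegreeLE.exists_polynomial {f : (∀ j : Fin d, Fin (n j) → K) → K}
    (hf : MultidegreeLE f (fun _ => 1)) :
    ∃ F : MvPolynomial (Σ j : Fin d, Fin (n j)) K, ∀ w, f w = eval (flatten w) F := by
  obtain ⟨F, hF⟩ := hf.exists_polynomial_piecewise Finset.univ 0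
  exact ⟨F, by simpa using hF⟩

/-! ### Polynomial families of points -/

/-- The point with parameter `a` in a polynomial family of points of the product of the blocks. -/
noncomputable def evalPoint {P : Type*} (φ : ∀ j : Fin d, Fin (n j) → MvPolynomial P K) (a : P → K) :
    ∀ j : Fin d, Fin (n j) → K :=
  fun j l => eval a (φ j l)

theorem MultidegreeLE.exists_polynomial_comp {f : (∀ j : Fin d, Fin (n j) → K) → K}
    (hf : MultidegreeLE f (fun _ => 1)) {P : Type*}
    (φ : ∀ j : Fin d, Fin (n j) → MvPolynomial P K) :
    ∃ q : MvPolynomial P K, ∀ a, f (evalPoint φ a) = eval a q := by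
  obtain ⟨F, hF⟩ := hf.exists_polynomial
  refine ⟨bind₁ (fun i => φ i.1 i.2) F, fun a => ?_⟩
  rw [hF, ← coe_aeval_eq_eval, ← coe_aeval_eq_eval, RingHom.coe_coe, RingHom.coe_coe, aeval_bind₁]
  rfl

theorem MultidegreeLE.exists_polynomial_slope_comp {f : (∀ j : Fin d, Fin (n j) → K) → K}
    (hf : MultidegreeLE f (fun _ => 1)) {P : Type*}
    (φ : ∀ j : Fin d, Fin (n j) → MvPolynomial P K) (k : Fin d) (l : Fin (n k)) :
    ∃ q : MvPolynomial P K, ∀ a, slope f k l (evalPoint φ a) = eval a q := by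
  have key : ∀ (y : Fin (n k) → MvPolynomial P K) (a : P → K),
      evalPoint (Function.update φ k y) a =
        Function.update (evalPoint φ a) k (fun l => eval a (y l)) := by
    intro y a
    funext j
    by_cases hj : j = k
    · subst hj
      funext i
      simp [evalPoint]
    · funext i
      simp [evalPoint, hj]
  obtain ⟨q₁, h₁⟩ := hf.exists_polynomial_comp (Function.update φ k (Pi.single l 1))
  obtain ⟨q₀, h₀⟩ := hf.exists_polynomial_comp (Function.update φ k 0)
  refine ⟨q₁ - q₀, fun a => ?_⟩
  rw [map_sub, ← h₁, ← h₀, key, key, slope]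
  congr 3
  funext i
  by_cases hi : i = l
  · subst hi
    simp
  · simp [hi]

end Blocks

/-! ### Triangular families of solutions of a linear system -/

/-- Over a commutative ring, a homogeneous linear system of `#μ` equations in `#ι` unknowns has
`#ι - #μ` solutions in triangular position. -/
theorem exists_triangular_solutions {R μ ι : Type*} [CommRing R] [Nontrivial R] [Fintype μ]
    [Fintype ι] (A : Matrix μ ι R) (t : ℕ) (ht : t ≤ Fintype.card ι - Fintype.card μ) :
    ∃ (e : Fin t → ι → R) (j : Fin t → ι), (∀ s, A.mulVec (e s) = 0) ∧
      (∀ s, e s (j s) ≠ 0) ∧ ∀ s s', s < s' → e s (j s') = 0 := by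
  induction t with
  | zero => exact ⟨Fin.elim0, Fin.elim0, fun s => s.elim0, fun s => s.elim0, fun s => s.elim0⟩
  | succ t ih =>
    obtain ⟨e, j, hA, hj, hlt⟩ := ih (by omega)
    -- One more solution, required to vanish at the `t` coordinates already used.
    let T : (ι → R) →ₗ[R] (μ ⊕ Fin t → R) :=
      { toFun := fun y => Sum.elim (A.mulVec y) (fun s => y (j s))
        map_add' := fun y z => by
          ext (i | s) <;> simp [Matrix.mulVec_add]
        map_smul' := fun r y => by
          ext (i | s) <;> simp [Matrix.mulVec_smul] }
    have hT : ¬ Function.Injective T := fun h => by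
      have := card_le_of_injective R T h
      rw [Fintype.card_sum, Fintype.card_fin] at this
      omega
    rw [injective_iff_map_eq_zero] at hT
    push Not at hT
    obtain ⟨y, hy, hy0⟩ := hT
    obtain ⟨i, hi⟩ := Function.ne_iff.1 hy0
    refine ⟨Fin.cons y e, Fin.cons i j, ?_, ?_, ?_⟩
    · refine Fin.cases ?_ fun s => ?_
      · ext r
        simpa [T] using congrFun hy (Sum.inl r)
      · simpa using hA s
    · refine Fin.cases ?_ fun s => ?_
      · simpa using hi
      · simpa using hj s
    · refine Fin.cases (Fin.cases (by simp) fun s' _ => ?_) fun s => Fin.cases (by simp) fun s' h => ?_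
      · simpa [T] using congrFun hy (Sum.inr s')
      · simpa using hlt s s' (by simpa using h)

/-! ### The Zariski topology on rational points -/

section Zariski

theorem isClosed_zariski_iff {L σ : Type*} [Field L] {Z : Set (σ → L)} :
    @IsClosed _ (zariskiTopology L σ) Z ↔ ∃ P : Set (MvPolynomial σ L), Z = commonZeros P := by
  let _ := zariskiTopology L σ
  rw [← isOpen_compl_iff]
  change Zᶜᶜ ∈ {Z | ∃ P : Set (MvPolynomial σ L), Z = commonZeros P} ↔ _
  rw [compl_compl]
  rfl

variable {K L σ τ : Type*} [Field K] [Field L] [Algebra K L]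

/-- The expansion of the coefficients of a polynomial along a basis of the field extension. -/
theorem exists_expansion {ι : Type*} (b : Module.Basis ι K L) (g : MvPolynomial σ L) :
    ∃ q : ι →₀ MvPolynomial σ K, g = q.sum fun i r => C (b i) * map (algebraMap K L) r := by
  classical
  have hadd : ∀ q q' : ι →₀ MvPolynomial σ K,
      (q + q').sum (fun i r => C (b i) * map (algebraMap K L) r) =
        q.sum (fun i r => C (b i) * map (algebraMap K L) r) +
          q'.sum (fun i r => C (b i) * map (algebraMap K L) r) := fun q q' =>
    Finsupp.sum_add_index' (by simp) (by simp [mul_add])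
  induction g using MvPolynomial.induction_on' with
  | monomial u c =>
    refine ⟨(b.repr c).mapRange (monomial u) (map_zero _), ?_⟩
    rw [Finsupp.sum_mapRange_index (by simp)]
    conv_lhs => rw [← b.linearCombination_repr c, Finsupp.linearCombination_apply]
    rw [Finsupp.sum, map_sum]
    refine Finset.sum_congr rfl fun i _ => ?_
    dsimp only
    rw [map_monomial, C_mul_monomial, Algebra.smul_def, mul_comm]
  | add g g' hg hg' =>
    obtain ⟨q, hq⟩ := hg
    obtain ⟨q', hq'⟩ := hg'
    exact ⟨q + q', by rw [hadd, ← hq, ← hq']⟩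

theorem eval_expansion {ι : Type*} (b : Module.Basis ι K L) (q : ι →₀ MvPolynomial σ K)
    (a : σ → L) :
    eval a (q.sum fun i r => C (b i) * map (algebraMap K L) r) =
      q.sum fun i r => b i * aeval a r := by
  rw [Finsupp.sum, map_sum, Finsupp.sum]
  refine Finset.sum_congr rfl fun i _ => ?_
  rw [map_mul, eval_C, eval_map, aeval_def]

/-- At a rational point, linear independence of the basis separates the components. -/
theorem eval_expansion_eq_zero_iff {ι : Type*} (b : Module.Basis ι K L)
    (q : ι →₀ MvPolynomial σ K) (a : σ → K) :
    eval (fun k => algebraMap K L (a k)) (q.sum fun i r => C (b i) * map (algebraMap K L) r) = 0 ↔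
      ∀ i, eval a (q i) = 0 := by
  have h : ∀ r : MvPolynomial σ K,
      aeval (fun k => algebraMap K L (a k)) r = algebraMap K L (eval a r) := fun r => by
    rw [← coe_aeval_eq_eval, RingHom.coe_coe]
    exact aeval_algebraMap_apply L a r
  have h2 : (q.sum fun i r => b i * aeval (fun k => algebraMap K L (a k)) r) =
      Finsupp.linearCombination K b (q.mapRange (eval a) (map_zero _)) := by
    rw [Finsupp.linearCombination_apply, Finsupp.sum_mapRange_index (by simp)]
    refine Finset.sum_congr rfl fun i _ => ?_
    simp only [h, Algebra.smul_def, mul_comm]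
  rw [eval_expansion, h2, map_eq_zero_iff _ b.linearIndependent]
  simp [DFunLike.ext_iff]

theorem continuous_algebraMap_zariski :
    @Continuous _ _ (zariskiTopology K σ) (zariskiTopology L σ)
      (fun (a : σ → K) k => algebraMap K L (a k)) := by
  let _ := zariskiTopology K σ
  let _ := zariskiTopology L σ
  refine continuous_iff_isClosed.2 fun Z hZ => ?_
  obtain ⟨P, rfl⟩ := isClosed_zariski_iff.1 hZ
  let b := Module.Basis.ofVectorSpace K L
  choose q hq using fun g : MvPolynomial σ L => exists_expansion b g
  refine isClosed_zariski_iff.2 ⟨{r | ∃ g ∈ P, ∃ i, r = q g i}, ?_⟩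
  ext a
  have key : ∀ g, eval (fun k => algebraMap K L (a k)) g = 0 ↔ ∀ i, eval a (q g i) = 0 := fun g => by
    conv_lhs => rw [hq g]
    exact eval_expansion_eq_zero_iff b (q g) a
  simp only [Set.mem_preimage, commonZeros, Set.mem_ofPred_eq, key]
  exact ⟨fun h r ⟨g, hg, i, hr⟩ => hr ▸ h g hg i, fun h g hg i => h _ ⟨g, hg, i, rfl⟩⟩

theorem continuous_polynomialMap_zariski (φ : σ → MvPolynomial τ K) :
    @Continuous _ _ (zariskiTopology K τ) (zariskiTopology K σ)
      (fun (a : τ → K) k => eval a (φ k)) := by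
  let _ := zariskiTopology K σ
  let _ := zariskiTopology K τ
  refine continuous_iff_isClosed.2 fun Z hZ => ?_
  obtain ⟨P, rfl⟩ := isClosed_zariski_iff.1 hZ
  refine isClosed_zariski_iff.2 ⟨bind₁ φ '' P, ?_⟩
  ext a
  have key : ∀ g, eval a (bind₁ φ g) = eval (fun k => eval a (φ k)) g := fun g => by
    rw [← coe_aeval_eq_eval, ← coe_aeval_eq_eval, RingHom.coe_coe, RingHom.coe_coe, aeval_bind₁]
  simp [commonZeros, key]

theorem isIrreducible_univ_zariski [Infinite K] : IsZariskiIrreducible (Set.univ : Set (τ → K)) := by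
  let _ := zariskiTopology K τ
  have aux : ∀ {U : Set (τ → K)}, IsOpen U → U.Nonempty →
      ∃ p : MvPolynomial τ K, p ≠ 0 ∧ ∀ a, eval a p ≠ 0 → a ∈ U := by
    rintro U hU ⟨x, hx⟩
    obtain ⟨P, hP⟩ := isClosed_zariski_iff.1 hU.isClosed_compl
    have hxP : x ∉ commonZeros P := hP ▸ fun h => h hx
    simp only [commonZeros, Set.mem_ofPred_eq, not_forall] at hxP
    obtain ⟨p, hp, hpx⟩ := hxP
    refine ⟨p, fun h => hpx (by simp [h]), fun a ha => ?_⟩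
    by_contra haU
    have : a ∈ commonZeros P := hP ▸ haU
    exact ha (this p hp)
  refine ⟨⟨0, trivial⟩, ?_⟩
  rintro U V hU hV ⟨x, -, hx⟩ ⟨y, -, hy⟩
  obtain ⟨p, hp, hpU⟩ := aux hU ⟨x, hx⟩
  obtain ⟨q, hq, hqV⟩ := aux hV ⟨y, hy⟩
  obtain ⟨a, ha⟩ : ∃ a, eval a (p * q) ≠ 0 := by
    by_contra! h
    exact mul_ne_zero hp hq (MvPolynomial.funext fun a => by simpa using h a)
  rw [map_mul] at ha
  exact ⟨a, trivial, hpU a (left_ne_zero_of_mul ha), hqV a (right_ne_zero_of_mul ha)⟩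

/-- The closure defined by the polynomials over the small field that vanish on a set of rational
points is the Zariski closure over the large field. -/
theorem geometricClosure_eq_closure (S : Set (σ → K)) :
    geometricClosure S =
      @closure _ (zariskiTopology (AlgebraicClosure K) σ)
        ((fun a k => algebraMap K (AlgebraicClosure K) (a k)) '' S) := by
  let _ := zariskiTopology (AlgebraicClosure K) σ
  have hev : ∀ (r : MvPolynomial σ K) (x : σ → AlgebraicClosure K),
      aeval x r = eval x (map (algebraMap K (AlgebraicClosure K)) r) := fun r x => by
    rw [eval_map, aeval_def]
  apply Set.Subset.antisymm
  · intro x hx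
    obtain ⟨P, hP⟩ := isClosed_zariski_iff.1
      (isClosed_closure (s := (fun a k => algebraMap K (AlgebraicClosure K) (a k)) '' S))
    rw [hP]
    intro g hg
    let b := Module.Basis.ofVectorSpace K (AlgebraicClosure K)
    obtain ⟨q, rfl⟩ := exists_expansion b g
    -- The components of `g` vanish on `S`, hence at `x`.
    have hq : ∀ i, q i ∈ vanishingIdeal K S := fun i a ha => by
      have hmem := subset_closure (Set.mem_image_of_mem
        (fun (a : σ → K) k => algebraMap K (AlgebraicClosure K) (a k)) ha)
      rw [hP] at hmem
      exact (eval_expansion_eq_zero_iff b q a).1 (hmem _ hg) i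
    rw [eval_expansion]
    exact Finset.sum_eq_zero fun i _ => mul_eq_zero_of_right _ (hx _ (hq i))
  · refine closure_minimal ?_ (isClosed_zariski_iff.2
      ⟨map (algebraMap K (AlgebraicClosure K)) '' {p | p ∈ vanishingIdeal K S}, ?_⟩)
    · rintro _ ⟨a, ha, rfl⟩ p hp
      exact (aeval_algebraMap_apply (AlgebraicClosure K) a p).trans (by rw [hp a ha, map_zero])
    · ext x
      simp [geometricClosure, commonZeros, hev, mem_zeroLocus_iff]

end Zariski

/-! ### Flags in the parameter space -/

section Flags

variable {K σ : Type*} [Field K]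

theorem isIrreducible_coordinateSubspace [Infinite K] {p : ℕ} (i : ℕ) :
    IsZariskiIrreducible {a : Fin p → K | ∀ j, i ≤ j.val → a j = 0} := by
  classical
  let _ := zariskiTopology K (Fin p)
  let π : Fin p → MvPolynomial (Fin p) K := fun j => if i ≤ j.val then 0 else X j
  have h := (isIrreducible_univ_zariski (K := K) (τ := Fin p)).image _
    (continuous_polynomialMap_zariski π).continuousOn
  refine (congrArg IsIrreducible ?_).mpr h
  ext a
  refine ⟨fun ha => ⟨a, trivial, ?_⟩, ?_⟩
  · funext j
    by_cases hj : i ≤ j.val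
    · simp [π, hj, ha j hj]
    · simp [π, hj]
  · rintro ⟨b, -, rfl⟩ j hj
    simp [π, hj]

theorem continuous_algebraMap_polynomialMap_zariski (L : Type*) [Field L] [Algebra K L] {τ : Type*}
    (φ : σ → MvPolynomial τ K) :
    @Continuous _ _ (zariskiTopology K τ) (zariskiTopology L σ)
      (fun (a : τ → K) k => algebraMap K L (eval a (φ k))) := by
  let _ := zariskiTopology K τ
  let _ := zariskiTopology K σ
  let _ := zariskiTopology L σ
  exact continuous_algebraMap_zariski.comp (continuous_polynomialMap_zariski φ)

theorem isIrreducible_geometricClosure_range [Infinite K] {τ : Type*} (φ : σ → MvPolynomial τ K) :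
    IsZariskiIrreducible (geometricClosure (Set.range fun (a : τ → K) k => eval a (φ k))) := by
  let _ := zariskiTopology K τ
  let _ := zariskiTopology (AlgebraicClosure K) σ
  rw [geometricClosure_eq_closure]
  have h := (isIrreducible_univ_zariski (K := K) (τ := τ)).image _
    (continuous_algebraMap_polynomialMap_zariski (AlgebraicClosure K) φ).continuousOn
  rw [Set.image_univ] at h
  rw [← Set.range_comp]
  exact h.closure

theorem algebraMap_mem_geometricClosure {S : Set (σ → K)} {a : σ → K} (ha : a ∈ S) :
    (fun k => algebraMap K (AlgebraicClosure K) (a k)) ∈ geometricClosure S := by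
  rw [geometricClosure_eq_closure]
  exact @subset_closure _ (zariskiTopology _ _) _ _ ⟨a, ha, rfl⟩

/-- The images of the standard flag of `K^p` form a chain of irreducible closed subsets, and `h`
says that any two consecutive ones are separated by a coordinate function. -/
theorem le_zariskiDim_geometricClosure_range [Infinite K] {p : ℕ} (φ : σ → MvPolynomial (Fin p) K)
    (h : ∀ i : Fin p, ∃ κ c, (∀ a : Fin p → K, (∀ j, i ≤ j → a j = 0) → eval a (φ κ) = c) ∧
      ∃ a : Fin p → K, (∀ j, i < j → a j = 0) ∧ eval a (φ κ) ≠ c) :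
    (p : WithBot ℕ∞) ≤
      zariskiDim (geometricClosure (Set.range fun (a : Fin p → K) k => eval a (φ k))) := by
  set V := geometricClosure (Set.range fun (a : Fin p → K) k => eval a (φ k)) with hV
  let _ := zariskiTopology K (Fin p)
  let _ := zariskiTopology (AlgebraicClosure K) σ
  have hmem : ∀ a : Fin p → K,
      (fun k => algebraMap K (AlgebraicClosure K) (eval a (φ k))) ∈ V := fun a =>
    algebraMap_mem_geometricClosure ⟨a, rfl⟩
  let ψ : (Fin p → K) → V := fun a => ⟨_, hmem a⟩
  have hψ : Continuous ψ :=
    (continuous_algebraMap_polynomialMap_zariski (AlgebraicClosure K) φ).subtype_mk hmem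
  let Z : ℕ → TopologicalSpace.IrreducibleCloseds V := fun i =>
    ⟨closure (ψ '' {a | ∀ j, i ≤ j.val → a j = 0}),
      ((isIrreducible_coordinateSubspace i).image _ hψ.continuousOn).closure, isClosed_closure⟩
  have hZ : ∀ i : Fin p, Z i < Z (i + 1) := by
    intro i
    obtain ⟨κ, c, hc, a, ha, hac⟩ := h i
    refine lt_of_le_not_ge (closure_mono (Set.image_mono fun a ha j hj => ha j (by omega))) fun hle => ?_
    have hclosed : IsClosed {x : σ → AlgebraicClosure K | x κ = algebraMap K _ c} :=
      isClosed_zariski_iff.2 ⟨{X κ - C (algebraMap K _ c)}, by ext; simp [commonZeros, sub_eq_zero]⟩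
    have hsub : closure (ψ '' {a | ∀ j, i.val ≤ j.val → a j = 0}) ⊆
        Subtype.val ⁻¹' {x : σ → AlgebraicClosure K | x κ = algebraMap K _ c} := by
      refine closure_minimal ?_ (hclosed.preimage continuous_subtype_val)
      rintro _ ⟨b, hb, rfl⟩
      exact congrArg (algebraMap K _) (hc b hb)
    have hain : ψ a ∈ closure (ψ '' {a | ∀ j, i.val + 1 ≤ j.val → a j = 0}) :=
      subset_closure ⟨a, fun j hj => ha j hj, rfl⟩
    exact hac ((algebraMap K (AlgebraicClosure K)).injective (hsub (hle hain)))
  let s : LTSeries (TopologicalSpace.IrreducibleCloseds V) := ⟨p, fun i => Z i, fun i => hZ i⟩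
  exact Order.LTSeries.length_le_krullDim s

end Flags

theorem zariskiCodim_le {L σ : Type*} [Field L] [Fintype σ] {S : Set (σ → L)} {p c : ℕ}
    (hp : (p : WithBot ℕ∞) ≤ zariskiDim S) (h : Fintype.card σ ≤ p + c) :
    zariskiCodim S ≤ (c : ℕ∞) := by
  refine sInf_le (le_trans ?_ (add_le_add_left hp _))
  exact_mod_cast h

/-! ### Construction of the parametrization -/

section Parametrization

variable {K : Type*} [Field K] {d m : ℕ} {n : Fin d → ℕ}

/-- A parametrization by `K^p` of part of the fibre of `f` through `v`, in which only the first `k`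
blocks move. The fibre condition is imposed at all points obtained by resetting some of the blocks
to those of `v`: this is what makes the equations of the next block linear and homogeneous. -/
structure FibreParametrization (f : Fin m → (∀ j : Fin d, Fin (n j) → K) → K)
    (v : ∀ j : Fin d, Fin (n j) → K) (k p : ℕ) where
  /-- The coordinates of the parametrized point. -/
  φ : ∀ j : Fin d, Fin (n j) → MvPolynomial (Fin p) K
  evalPoint_zero : evalPoint φ 0 = v
  evalPoint_of_le : ∀ a, ∀ j : Fin d, k ≤ j.val → evalPoint φ a j = v j
  fibre : ∀ i, ∀ S : Finset (Fin d), ∀ a, f i (S.piecewise (evalPoint φ a) v) = f i v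
  triangular : ∀ i : Fin p, ∃ κ : Σ j : Fin d, Fin (n j),
    (∀ a : Fin p → K, (∀ j, i ≤ j → a j = 0) → eval a (φ κ.1 κ.2) = v κ.1 κ.2) ∧
      ∃ a : Fin p → K, (∀ j, i < j → a j = 0) ∧ eval a (φ κ.1 κ.2) ≠ v κ.1 κ.2

/-- Nothing moves. -/
noncomputable def FibreParametrization.const (f : Fin m → (∀ j : Fin d, Fin (n j) → K) → K)
    (v : ∀ j : Fin d, Fin (n j) → K) : FibreParametrization f v 0 0 where
  φ := fun j l => C (v j l)
  evalPoint_zero := by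
    funext j l
    simp [evalPoint]
  evalPoint_of_le := fun a j _ => by
    funext l
    simp [evalPoint]
  fibre := fun i S a => by
    have : evalPoint (fun j l => C (v j l)) a = v := by
      funext j l
      simp [evalPoint]
    rw [this, Finset.piecewise_same]
  triangular := fun i => i.elim0

/-- The new parameters are the coefficients of a triangular family of solutions, over the ring of
polynomials in the old parameters, of the `2 ^ k * m` linear equations for the displacement of the
block `k`. -/
theorem FibreParametrization.exists_succ [Infinite K]
    {f : Fin m → (∀ j : Fin d, Fin (n j) → K) → K}
    (hf : ∀ i, MultidegreeLE (f i) (fun _ => 1)) {v : ∀ j : Fin d, Fin (n j) → K} {p : ℕ}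
    (k : Fin d) (Φ : FibreParametrization f v k p) :
    Nonempty (FibreParametrization f v (k + 1) (p + (n k - 2 ^ k.val * m))) := by
  classical
  obtain ⟨φ, hφ0, hφv, hφf, hφt⟩ := Φ
  set t := n k - 2 ^ k.val * m with ht
  let μ := (Finset.Iio k).powerset × Fin m
  have hpw : ∀ (S : Finset (Fin d)) a, evalPoint (S.piecewise φ fun j l => C (v j l)) a =
      S.piecewise (evalPoint φ a) v := by
    intro S a
    funext j l
    by_cases hj : j ∈ S <;> simp [evalPoint, hj]
  choose A hA using fun (r : μ) (l : Fin (n k)) =>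
    (hf r.2).exists_polynomial_slope_comp (r.1.1.piecewise φ fun j l => C (v j l)) k l
  simp only [hpw] at hA
  have hcard : t ≤ Fintype.card (Fin (n k)) - Fintype.card μ := by
    rw [Fintype.card_prod, Fintype.card_coe, Finset.card_powerset, Fin.card_Iio]
    simp [ht]
  obtain ⟨e, c, he, hec, hlt⟩ := exists_triangular_solutions (Matrix.of A) t hcard
  -- The displacement of the block `k`.
  let y : (Fin p → K) → (Fin t → K) → Fin (n k) → K := fun a b l => ∑ s, b s * eval a (e s l)
  have hy : ∀ (S : Finset (Fin d)) i a b, S ⊆ Finset.Iio k →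
      ∑ l, y a b l * slope (f i) k l (S.piecewise (evalPoint φ a) v) = 0 := by
    intro S i a b hS
    simp only [y, Finset.sum_mul]
    rw [Finset.sum_comm]
    refine Finset.sum_eq_zero fun s _ => ?_
    have h := congrArg (eval a) (congrFun (he s) (⟨S, Finset.mem_powerset.2 hS⟩, i))
    simp only [Matrix.mulVec, dotProduct, Matrix.of_apply, map_sum, map_mul, ← hA,
      Pi.zero_apply, map_zero] at h
    rw [← mul_zero (b s), ← h, Finset.mul_sum]
    exact Finset.sum_congr rfl fun l _ => by ring
  let φ' : ∀ j : Fin d, Fin (n j) → MvPolynomial (Fin (p + t)) K :=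
    Function.update (fun j l => rename (Fin.castAdd t) (φ j l)) k
      fun l => C (v k l) + ∑ s, X (Fin.natAdd p s) * rename (Fin.castAdd t) (e s l)
  have hφ' : ∀ a', evalPoint φ' a' = Function.update (evalPoint φ (a' ∘ Fin.castAdd t)) k
      (v k + y (a' ∘ Fin.castAdd t) (a' ∘ Fin.natAdd p)) := by
    intro a'
    funext j l
    by_cases hj : j = k
    · subst hj
      simp [evalPoint, φ', y, eval_rename]
    · simp [evalPoint, φ', hj, eval_rename]
  refine ⟨⟨φ', ?_, ?_, ?_, ?_⟩⟩
  · rw [hφ']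
    have h0 : (0 : Fin (p + t) → K) ∘ Fin.castAdd t = 0 := rfl
    have h1 : y 0 ((0 : Fin (p + t) → K) ∘ Fin.natAdd p) = 0 := by
      funext l
      simp [y]
    rw [h0, h1, hφ0, add_zero, Function.update_eq_self]
  · intro a j hj
    rw [hφ', Function.update_of_ne (by rintro rfl; omega), hφv _ _ (by omega)]
  · intro i S a'
    rw [hφ']
    set a := a' ∘ Fin.castAdd t
    by_cases hk : k ∈ S
    · have hS : S.piecewise (Function.update (evalPoint φ a) k (v k + y a (a' ∘ Fin.natAdd p))) v =
          Function.update ((S ∩ Finset.Iio k).piecewise (evalPoint φ a) v) k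
            ((S ∩ Finset.Iio k).piecewise (evalPoint φ a) v k + y a (a' ∘ Fin.natAdd p)) := by
        funext j
        by_cases hj : j = k
        · subst hj
          simp [hk]
        · by_cases hjS : j ∈ S
          · rcases lt_or_gt_of_ne hj with h | h
            · simp [hj, hjS, h]
            · simp [hj, hjS, h.le, hφv a j (Fin.le_def.1 h.le)]
          · simp [hj, hjS]
      rw [hS, (hf i).update_add, hy _ _ _ _ Finset.inter_subset_right, add_zero, hφf]
    · rw [← hφf i S a]
      congr 1
      funext j
      by_cases hjS : j ∈ S
      · have hj : j ≠ k := fun h => hk (h ▸ hjS)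
        simp [hj, hjS]
      · simp [hjS]
  · have hval : ∀ a' j l, eval a' (φ' j l) = evalPoint φ' a' j l := fun _ _ _ => rfl
    simp only [hval, hφ']
    refine Fin.addCases (fun i => ?_) fun s => ?_
    · obtain ⟨⟨j, l⟩, hκ, a, ha, hne⟩ := hφt i
      have hjk : j ≠ k := by
        rintro rfl
        exact hne (congrFun (hφv a j le_rfl) l)
      refine ⟨⟨j, l⟩, fun a' ha' => ?_, Fin.append a 0, ?_, ?_⟩
      · rw [Function.update_of_ne hjk]
        exact hκ _ fun i' hi' => ha' _ hi'
      · refine Fin.addCases (fun i' hi' => ?_) fun s _ => ?_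
        · simpa using ha i' hi'
        · simp
      · rw [Function.update_of_ne hjk]
        have : Fin.append a (0 : Fin t → K) ∘ Fin.castAdd t = a := by
          funext i'
          simp
        rwa [this]
    · -- The coordinate `c s` of the displacement is not affected by the first `s` new parameters.
      obtain ⟨a, ha⟩ : ∃ a, eval a (e s (c s)) ≠ 0 := by
        by_contra! h
        exact hec s (MvPolynomial.funext fun a => by simpa using h a)
      refine ⟨⟨k, c s⟩, fun a' ha' => ?_, Fin.append a (Pi.single s 1), ?_, ?_⟩
      · simp only [Function.update_self, Pi.add_apply, add_eq_left, y]
        refine Finset.sum_eq_zero fun s' _ => ?_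
        rcases lt_or_ge s' s with h | h
        · rw [hlt _ _ h, map_zero, mul_zero]
        · rw [Function.comp_apply, ha' _ (by simpa using h), zero_mul]
      · refine Fin.addCases (fun i' hi' => ?_) fun s' hs' => ?_
        · rw [Fin.lt_def, Fin.val_natAdd, Fin.val_castAdd] at hi'
          omega
        · have : s' ≠ s := by
            rintro rfl
            exact lt_irrefl _ hs'
          simp [this]
      · have h1 : Fin.append a (Pi.single s (1 : K)) ∘ Fin.castAdd t = a := by
          funext i'
          simp
        have h2 : Fin.append a (Pi.single s (1 : K)) ∘ Fin.natAdd p = Pi.single s 1 := by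
          funext s'
          simp
        rw [h1, h2]
        simpa [y, Pi.single_apply] using ha

theorem FibreParametrization.exists_of_le [Infinite K]
    {f : Fin m → (∀ j : Fin d, Fin (n j) → K) → K}
    (hf : ∀ i, MultidegreeLE (f i) (fun _ => 1)) (v : ∀ j : Fin d, Fin (n j) → K) :
    ∀ k ≤ d, ∃ p, Nonempty (FibreParametrization f v k p) ∧
      ∑ j with j.val < k, n j + m ≤ p + 2 ^ k * m
  | 0, _ => ⟨0, ⟨.const f v⟩, by simp⟩
  | k + 1, hk => by
    obtain ⟨p, ⟨Φ⟩, hp⟩ := exists_of_le hf v k (by omega)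
    refine ⟨_, Φ.exists_succ hf ⟨k, hk⟩, ?_⟩
    have hsum : ∑ j with j.val < k + 1, n j = n ⟨k, hk⟩ + ∑ j with j.val < k, n j := by
      have : Finset.univ.filter (fun j : Fin d => j.val < k + 1) =
          insert ⟨k, hk⟩ (Finset.univ.filter fun j : Fin d => j.val < k) := by
        ext j
        simp [Fin.ext_iff]
        omega
      rw [this, Finset.sum_insert (by simp)]
    rw [hsum, pow_succ]
    dsimp only
    have : 2 ^ k * 2 * m = 2 ^ k * m + 2 ^ k * m := by ring
    omega

end Parametrization

end MultilinearVariety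

theorem mainTheorem4 {K : Type*} [Field K] [Infinite K] {d m : ℕ} (n : Fin d → ℕ)
    (f : Fin m → (∀ j : Fin d, Fin (n j) → K) → K)
    (hf : ∀ i : Fin m, MultilinearVariety.MultidegreeLE (f i) (fun _ => 1))
    (c : Fin m → K) (v : ∀ j : Fin d, Fin (n j) → K) (hv : ∀ i : Fin m, f i v = c i) :
    ∃ W : Set (∀ j : Fin d, Fin (n j) → K),
      W ⊆ {w | ∀ i : Fin m, f i w = c i} ∧
      (fun k => algebraMap K (AlgebraicClosure K) (MultilinearVariety.flatten v k)) ∈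
        MultilinearVariety.geometricClosure (MultilinearVariety.flatten '' W) ∧
      MultilinearVariety.IsZariskiIrreducible
        (MultilinearVariety.geometricClosure (MultilinearVariety.flatten '' W)) ∧
      MultilinearVariety.zariskiCodim
        (MultilinearVariety.geometricClosure (MultilinearVariety.flatten '' W)) ≤
          ((2 ^ d * m : ℕ) : ℕ∞) := by
  obtain ⟨p, ⟨Φ⟩, hp⟩ :=
    MultilinearVariety.FibreParametrization.exists_of_le hf v d le_rfl
  let φ : (Σ j : Fin d, Fin (n j)) → MvPolynomial (Fin p) K := fun κ => Φ.φ κ.1 κ.2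
  have himage : MultilinearVariety.flatten '' Set.range (MultilinearVariety.evalPoint Φ.φ) =
      Set.range fun (a : Fin p → K) κ => MvPolynomial.eval a (φ κ) := by
    rw [← Set.range_comp]
    rfl
  refine ⟨Set.range (MultilinearVariety.evalPoint Φ.φ), ?_, ?_, ?_, ?_⟩
  · rintro _ ⟨a, rfl⟩ i
    simpa [hv] using Φ.fibre i Finset.univ a
  · exact MultilinearVariety.algebraMap_mem_geometricClosure ⟨v, ⟨0, Φ.evalPoint_zero⟩, rfl⟩
  · rw [himage]
    exact MultilinearVariety.isIrreducible_geometricClosure_range φ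
  · rw [himage]
    refine MultilinearVariety.zariskiCodim_le
      (MultilinearVariety.le_zariskiDim_geometricClosure_range φ fun i => ?_) ?_
    · obtain ⟨κ, h⟩ := Φ.triangular i
      exact ⟨κ, v κ.1 κ.2, h⟩
    · have hcard : Fintype.card (Σ j : Fin d, Fin (n j)) = ∑ j with j.val < d, n j := by
        simp
      omega
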